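/- Let $Z=(Z_t)_{t\ge 0}$ be a real-valued centered stationary Gaussian process with continuous paths, defined on a probability space. Put $f_Z:=\mathbb E[Z_0^2]$, let $\rho(r)=\rho(-r):=\mathbb E[Z_rZ_0]$ for $r\ge 0$, and assume that $\int_{\mathbb R}\rho^2(r)\,dr<\infty$. For $T>0$ let $$\widehat f_T(Z):=\frac1T\int_0^T Z_t^2\,dt .$$ Then the following hold. 1. For every $T>0$ the estimator $\widehat f_T(Z)$ is unbiased: it is integrable and $\mathbb E[\widehat f_T(Z)]=f_Z$. 2. The estimator is strongly consistent: $\widehat f_T(Z)\to f_Z$ almost surely as $T\to\infty$, $T\in(0,\infty)$. 3. For every $T>0$ the error $\widehat f_T(Z)-f_Z$ is square integrable, the function $T\mapsto\sqrt T\,\|\widehat f_T(Z)-f_Z\|_{L^2}$ is nondecreasing on $(0,\infty)$, and as $T\to\infty$ it converges to $$\sigma_Z:=\Big(4\int_0^\infty\rho^2(r)\,dr\Big)^{1/2}=\Big(2\int_{\mathbb R}\rho^2(r)\,dr\Big)^{1/2}.$$ -/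

import Mathlib

open MeasureTheory ProbabilityTheory Filter Topology
open scoped NNReal

noncomputable section

namespace SecondMoment

variable {Ω : Type*} [MeasurableSpace Ω]

/-- The process `Z = (Z_t)_{t ≥ 0}` is (strictly) stationary under `P`: its finite-dimensional
distributions are invariant under time shifts. -/
def IsStationary (Z : ℝ≥0 → Ω → ℝ) (P : Measure Ω) : Prop :=
  ∀ (h : ℝ≥0) (I : Finset ℝ≥0),
    IdentDistrib (fun ω (t : I) => Z ((t : ℝ≥0) + h) ω) (fun ω (t : I) => Z (t : ℝ≥0) ω) P P

/-- The autocovariance function of a centered stationary process, extended evenly to the real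
line: `ρ(r) = E[Z_{|r|} Z_0]`. -/
def rho (Z : ℝ≥0 → Ω → ℝ) (P : Measure Ω) (r : ℝ) : ℝ :=
  ∫ ω, Z (Real.nnabs r) ω * Z 0 ω ∂P

/-- The quantity to be estimated, `f_Z = E[Z_0 ^ 2]`. -/
def secondMoment (Z : ℝ≥0 → Ω → ℝ) (P : Measure Ω) : ℝ :=
  ∫ ω, Z 0 ω ^ 2 ∂P

/-- The continuous-time estimator `(1 / T) ∫_0^T Z_t ^ 2 dt`, computed path by path. -/
def estimator (Z : ℝ≥0 → Ω → ℝ) (T : ℝ) (ω : Ω) : ℝ :=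
  (1 / T) * ∫ t in (0 : ℝ)..T, Z t.toNNReal ω ^ 2

/-- The limiting standard deviation `σ_Z = (4 ∫_0^∞ ρ(r) ^ 2 dr) ^ (1 / 2)`. -/
def sigma (Z : ℝ≥0 → Ω → ℝ) (P : Measure Ω) : ℝ :=
  √(4 * ∫ r in Set.Ioi (0 : ℝ), rho Z P r ^ 2)

/-- The normalized error `√T ‖f̂_T(Z) - f_Z‖_{L²(P)}`. -/
def scaledError (Z : ℝ≥0 → Ω → ℝ) (P : Measure Ω) (T : ℝ) : ℝ :=
  √T * (eLpNorm (fun ω => estimator Z T ω - secondMoment Z P) 2 P).toReal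

end SecondMoment

end

/-! For a centered Gaussian pair, Isserlis' formula gives `Cov(Z_s², Z_t²) = 2ρ(s - t)²`. Writing
the squared error as a double integral over `(0, T]²` and applying Fubini, `T · E[(f̂_T - f_Z)²] = 2
∫ ρ(r)² (1 - |r|/T)₊ dr`. The triangular weight increases to `1` with `T`, which yields both the
monotonicity and, by dominated convergence, the limit `σ_Z²`.

The same formula bounds the variance by `C/T`, which is summable along `T = (n + 1)²`, so the
estimator converges almost surely along squares. Since `T f̂_T` is nondecreasing in `T` and
consecutive squares have ratio tending to `1`, the convergence extends to all real `T`. -/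

/-! ### Fourth moments of Gaussian variables -/

namespace ProbabilityTheory

/-- The fourth moment of a centered real Gaussian distribution. -/
theorem integral_pow_four_gaussianReal (v : ℝ≥0) :
    ∫ x, x ^ 4 ∂(gaussianReal 0 v) = 3 * (v : ℝ) ^ 2 := by
  have h := iteratedDeriv_mgf_zero (X := id) (μ := gaussianReal 0 v) (by simp) 4
  rw [mgf_id_gaussianReal] at h
  -- Each derivative of the mgf is a polynomial times `exp(v t² / 2)`; differentiation sends `p` to
  -- `p' + v t p`.
  have hstep : ∀ p p' : ℝ → ℝ, (∀ t, HasDerivAt p (p' t) t) →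
      deriv (fun t => p t * Real.exp (v * t ^ 2 / 2)) =
        fun t => (p' t + p t * (v * t)) * Real.exp (v * t ^ 2 / 2) := by
    intro p p' hp
    funext t
    have he : HasDerivAt (fun t : ℝ => (v : ℝ) * t ^ 2 / 2) (v * t) t := by
      refine ((((hasDerivAt_id t).pow 2).const_mul (v : ℝ)).div_const 2).congr_deriv ?_
      simp
      ring
    refine (((hp t).mul he.exp).congr_deriv ?_).deriv
    ring
  have h0 : (fun t : ℝ => Real.exp ((0 : ℝ) * t + v * t ^ 2 / 2)) =
      fun t => (1 : ℝ) * Real.exp (v * t ^ 2 / 2) := by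
    funext t
    simp
  have hid := fun t : ℝ => hasDerivAt_id' t
  rw [h0, iteratedDeriv_eq_iterate] at h
  simp only [Function.iterate_succ, Function.comp, Function.iterate_zero, id] at h
  -- The polynomials stay in the unsimplified form that `hstep` produces, so that each rewrite
  -- matches.
  rw [hstep (fun _ => 1) (fun _ => 0) (fun t => hasDerivAt_const t 1),
    hstep (fun t => 0 + 1 * (v * t)) (fun _ => v)
      (fun t => by simpa using (hid t).const_mul (v : ℝ)),
    hstep (fun t => v + (0 + 1 * (v * t)) * (v * t)) (fun t => 2 * v ^ 2 * t)
      (fun t => by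
        have := (((hid t).pow 2).const_mul ((v : ℝ) ^ 2)).const_add (v : ℝ)
        refine (this.congr_deriv ?_).congr_of_eventuallyEq (.of_forall fun x => ?_) <;>
          simp <;> ring),
    hstep (fun t => 2 * v ^ 2 * t + (v + (0 + 1 * (v * t)) * (v * t)) * (v * t))
      (fun t => 3 * v ^ 2 + 3 * v ^ 3 * t ^ 2)
      (fun t => by
        have := ((hid t).const_mul (3 * (v : ℝ) ^ 2)).add
          (((hid t).pow 3).const_mul ((v : ℝ) ^ 3))
        refine (this.congr_deriv ?_).congr_of_eventuallyEq (.of_forall fun x => ?_) <;>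
          simp <;> ring)] at h
  simpa using h.symm

variable {Ω : Type*} [MeasurableSpace Ω] {P : Measure Ω} {X Y : Ω → ℝ}

theorem HasGaussianLaw.integrable_pow (hX : HasGaussianLaw X P) (n : ℕ) :
    Integrable (fun ω => X ω ^ n) P := by
  have := hX.isProbabilityMeasure
  refine (integrable_norm_iff (hX.aemeasurable.pow_const n).aestronglyMeasurable).1 ?_
  simpa [norm_pow] using (hX.memLp (p := n) (by simp)).integrable_norm_pow'

theorem HasGaussianLaw.integral_pow_four (hX : HasGaussianLaw X P) (h0 : ∫ ω, X ω ∂P = 0) :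
    ∫ ω, X ω ^ 4 ∂P = 3 * (∫ ω, X ω ^ 2 ∂P) ^ 2 := by
  have hmap := hX.map_eq_gaussianReal
  rw [h0] at hmap
  have hv : Var[X; P] = ∫ ω, X ω ^ 2 ∂P := variance_of_integral_eq_zero hX.aemeasurable h0
  have h := integral_map (f := fun x : ℝ => x ^ 4) hX.aemeasurable (by fun_prop)
  rw [← h, hmap, integral_pow_four_gaussianReal, Real.coe_toNNReal _ (variance_nonneg X P), hv]

theorem HasGaussianLaw.integrable_sq_mul_sq (hX : HasGaussianLaw X P) (hY : HasGaussianLaw Y P) :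
    Integrable (fun ω => X ω ^ 2 * Y ω ^ 2) P := by
  have := hX.isProbabilityMeasure
  refine ((hX.integrable_pow 4).add (hY.integrable_pow 4)).mono'
    ((hX.aemeasurable.pow_const 2).mul (hY.aemeasurable.pow_const 2)).aestronglyMeasurable
    (.of_forall fun ω => ?_)
  rw [Real.norm_of_nonneg (by positivity)]
  simp only [Pi.add_apply]
  nlinarith [sq_nonneg (X ω ^ 2 - Y ω ^ 2), sq_nonneg (X ω ^ 2 + Y ω ^ 2)]

theorem HasGaussianLaw.integrable_mul (hX : HasGaussianLaw X P) (hY : HasGaussianLaw Y P) :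
    Integrable (fun ω => X ω * Y ω) P :=
  hX.memLp_two.integrable_mul hY.memLp_two

/-- Isserlis' formula for the mixed fourth moment of a centered Gaussian pair. -/
theorem HasGaussianLaw.integral_sq_mul_sq (hXY : HasGaussianLaw (fun ω => (X ω, Y ω)) P)
    (hX0 : ∫ ω, X ω ∂P = 0) (hY0 : ∫ ω, Y ω ∂P = 0) :
    ∫ ω, X ω ^ 2 * Y ω ^ 2 ∂P =
      (∫ ω, X ω ^ 2 ∂P) * (∫ ω, Y ω ^ 2 ∂P) + 2 * (∫ ω, X ω * Y ω ∂P) ^ 2 := by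
  have hX := hXY.fst
  have hY := hXY.snd
  -- Joint Gaussianity enters here: it makes `X ± Y` Gaussian.
  have hA := hXY.fun_add
  have hS := hXY.fun_sub
  have hX2 := hX.integrable_pow 2
  have hY2 := hY.integrable_pow 2
  have hM := hX.integrable_mul hY
  have hA4 := hA.integral_pow_four (by rw [integral_add hX.integrable hY.integrable, hX0, hY0]; simp)
  have hS4 := hS.integral_pow_four (by rw [integral_sub hX.integrable hY.integrable, hX0, hY0]; simp)
  have hA2 : ∫ ω, (X ω + Y ω) ^ 2 ∂P =
      ∫ ω, X ω ^ 2 ∂P + ∫ ω, Y ω ^ 2 ∂P + 2 * ∫ ω, X ω * Y ω ∂P := by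
    rw [← integral_const_mul, ← integral_add hX2 hY2, ← integral_add (hX2.fun_add hY2) (hM.const_mul 2)]
    congr 1 with ω
    ring
  have hS2 : ∫ ω, (X ω - Y ω) ^ 2 ∂P =
      ∫ ω, X ω ^ 2 ∂P + ∫ ω, Y ω ^ 2 ∂P - 2 * ∫ ω, X ω * Y ω ∂P := by
    rw [← integral_const_mul, ← integral_add hX2 hY2, ← integral_sub (hX2.fun_add hY2) (hM.const_mul 2)]
    congr 1 with ω
    ring
  -- Polarization: `(x + y)⁴ + (x - y)⁴ = 2x⁴ + 12x²y² + 2y⁴`.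
  have hsum : 12 * ∫ ω, X ω ^ 2 * Y ω ^ 2 ∂P = ∫ ω, (X ω + Y ω) ^ 4 ∂P + ∫ ω, (X ω - Y ω) ^ 4 ∂P
      - 2 * ∫ ω, X ω ^ 4 ∂P - 2 * ∫ ω, Y ω ^ 4 ∂P := by
    have hA4i := hA.integrable_pow 4
    have hS4i := hS.integrable_pow 4
    have hX4i := (hX.integrable_pow 4).const_mul 2
    have hY4i := (hY.integrable_pow 4).const_mul 2
    have hD : Integrable (fun ω => (X ω + Y ω) ^ 4 + (X ω - Y ω) ^ 4 - 2 * X ω ^ 4) P :=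
      (hA4i.add hS4i).sub hX4i
    rw [← integral_const_mul, ← integral_const_mul, ← integral_const_mul, ← integral_add hA4i hS4i,
      ← integral_sub (hA4i.fun_add hS4i) hX4i, ← integral_sub hD hY4i]
    congr 1 with ω
    ring
  rw [hA4, hS4, hA2, hS2, hX.integral_pow_four hX0, hY.integral_pow_four hY0] at hsum
  linear_combination hsum / 12

end ProbabilityTheory

/-! ### Interpolation between squares -/

/-- A monotone function whose averages converge along the squares has convergent averages. -/
theorem MonotoneOn.tendsto_div_of_tendsto_sq {A : ℝ → ℝ} {l : ℝ} (hA : MonotoneOn A (Set.Ici 0))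
    (h0 : 0 ≤ A 0)
    (h : Tendsto (fun n : ℕ => A (((n : ℝ) + 1) ^ 2) / ((n : ℝ) + 1) ^ 2) atTop (𝓝 l)) :
    Tendsto (fun T => A T / T) atTop (𝓝 l) := by
  have h1 : Tendsto (fun n : ℕ => A ((n : ℝ) ^ 2) / (n : ℝ) ^ 2) atTop (𝓝 l) := by
    rw [← tendsto_add_atTop_iff_nat 1]
    simpa using h
  have hr : Tendsto (fun n : ℕ => (n : ℝ) / ((n : ℝ) + 1)) atTop (𝓝 1) :=
    tendsto_natCast_div_add_atTop 1
  have hfl : Tendsto (fun T : ℝ => ⌊√T⌋₊) atTop atTop :=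
    tendsto_nat_floor_atTop.comp Real.tendsto_sqrt_atTop
  -- With `n = ⌊√T⌋`, monotonicity and nonnegativity squeeze `A T / T` between `A(n²)/(n + 1)²` and
  -- `A((n + 1)²)/n²`.
  have hlow : Tendsto (fun n : ℕ => A ((n : ℝ) ^ 2) / (n : ℝ) ^ 2 * ((n : ℝ) / ((n : ℝ) + 1)) ^ 2)
      atTop (𝓝 l) := by
    simpa using h1.mul (hr.pow 2)
  have hup : Tendsto (fun n : ℕ => A (((n : ℝ) + 1) ^ 2) / ((n : ℝ) + 1) ^ 2 /
      ((n : ℝ) / ((n : ℝ) + 1)) ^ 2) atTop (𝓝 l) := by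
    simpa [Pi.div_def] using h.div (hr.pow 2) (by simp)
  have hnonneg : ∀ x : ℝ, 0 ≤ x → 0 ≤ A x := fun x hx =>
    h0.trans (hA (by simp) hx hx)
  have hle : ∀ T : ℝ, 0 ≤ T → (⌊√T⌋₊ : ℝ) ^ 2 ≤ T := fun T hT =>
    calc (⌊√T⌋₊ : ℝ) ^ 2 ≤ √T ^ 2 := by gcongr; exact Nat.floor_le (Real.sqrt_nonneg T)
      _ = T := Real.sq_sqrt hT
  have hlt : ∀ T : ℝ, 0 ≤ T → T ≤ ((⌊√T⌋₊ : ℝ) + 1) ^ 2 := fun T hT =>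
    calc T = √T ^ 2 := (Real.sq_sqrt hT).symm
      _ ≤ _ := by gcongr; exact (Nat.lt_floor_add_one _).le
  refine tendsto_of_tendsto_of_tendsto_of_le_of_le' (hlow.comp hfl) (hup.comp hfl) ?_ ?_ <;>
  filter_upwards [eventually_gt_atTop 0, hfl.eventually_ge_atTop 1] with T hT hn <;>
  replace hle := hle T hT.le <;>
  replace hlt := hlt T hT.le
  · have hn' : (0 : ℝ) < ⌊√T⌋₊ := by exact_mod_cast hn
    simp only [Function.comp]
    set n : ℝ := (⌊√T⌋₊ : ℝ)
    calc A (n ^ 2) / n ^ 2 * (n / (n + 1)) ^ 2 = A (n ^ 2) / (n + 1) ^ 2 := by field_simp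
      _ ≤ A T / T := by
        have : A (n ^ 2) ≤ A T := hA (by simp; positivity) (by simp; linarith) hle
        have := hnonneg T (by linarith)
        gcongr
  · have hn' : (0 : ℝ) < ⌊√T⌋₊ := by exact_mod_cast hn
    simp only [Function.comp]
    set n : ℝ := (⌊√T⌋₊ : ℝ)
    calc A T / T ≤ A ((n + 1) ^ 2) / n ^ 2 := by
          have : A T ≤ A ((n + 1) ^ 2) := hA (by simp; linarith) (by simp; positivity) hlt
          have := hnonneg ((n + 1) ^ 2) (by positivity)
          gcongr
      _ = _ := by field_simp

/-! ### Summable expectations and difference kernels -/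

namespace MeasureTheory

/-- By Tonelli the series has finite expectation, so it converges almost surely and its terms vanish
in the limit. -/
theorem ae_tendsto_zero_of_summable_integral {Ω : Type*} [MeasurableSpace Ω] {P : Measure Ω}
    {g : ℕ → Ω → ℝ} (hg : ∀ n, Integrable (g n) P) (hnn : ∀ n ω, 0 ≤ g n ω)
    (hs : Summable fun n => ∫ ω, g n ω ∂P) :
    ∀ᵐ ω ∂P, Tendsto (fun n => g n ω) atTop (𝓝 0) := by
  have hm : ∀ n, AEMeasurable (fun ω => ENNReal.ofReal (g n ω)) P :=
    fun n => (hg n).aemeasurable.ennreal_ofReal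
  have hfin : ∫⁻ ω, ∑' n, ENNReal.ofReal (g n ω) ∂P ≠ ⊤ := by
    rw [lintegral_tsum hm]
    simp_rw [← ofReal_integral_eq_lintegral_ofReal (hg _) (.of_forall (hnn _))]
    exact hs.tsum_ofReal_ne_top
  filter_upwards [ae_lt_top' (AEMeasurable.tsum hm) hfin] with ω hω
  have := ENNReal.tendsto_atTop_zero_of_tsum_ne_top hω.ne
  have := (ENNReal.tendsto_toReal (by simp)).comp this
  simpa [Function.comp_def, ENNReal.toReal_ofReal (hnn _ ω)] using this

/-- The double integral of a difference kernel over a square. -/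
theorem integral_integral_sub_Ioc {g : ℝ → ℝ} (hg : Integrable g) (T : ℝ) :
    ∫ t in Set.Ioc 0 T, ∫ s in Set.Ioc 0 T, g (s - t) = ∫ r, g r * max (T - |r|) 0 := by
  have hmeas : MeasurableSet {p : ℝ × ℝ | p.2 + p.1 ∈ Set.Ioc 0 T} :=
    (measurable_snd.add measurable_fst) measurableSet_Ioc
  have hint : Integrable ({p : ℝ × ℝ | p.2 + p.1 ∈ Set.Ioc 0 T}.indicator fun p => g p.2)
      ((volume.restrict (Set.Ioc 0 T)).prod volume) :=
    (hg.comp_snd _).indicator hmeas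
  calc ∫ t in Set.Ioc 0 T, ∫ s in Set.Ioc 0 T, g (s - t)
      = ∫ t in Set.Ioc 0 T, ∫ r,
          {p : ℝ × ℝ | p.2 + p.1 ∈ Set.Ioc 0 T}.indicator (fun p => g p.2) (t, r) := by
        congr 1 with t
        rw [← integral_sub_right_eq_self (fun r =>
          {p : ℝ × ℝ | p.2 + p.1 ∈ Set.Ioc 0 T}.indicator (fun p => g p.2) (t, r)) t,
          ← integral_indicator measurableSet_Ioc]
        congr 1 with s
        simp [Set.indicator]
    _ = ∫ r, ∫ t in Set.Ioc 0 T,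
          {p : ℝ × ℝ | p.2 + p.1 ∈ Set.Ioc 0 T}.indicator (fun p => g p.2) (t, r) :=
        integral_integral_swap (f := fun t r =>
          {p : ℝ × ℝ | p.2 + p.1 ∈ Set.Ioc 0 T}.indicator (fun p => g p.2) (t, r)) hint
    _ = ∫ r, g r * max (T - |r|) 0 := by
        congr 1 with r
        -- After the substitution `s = r + t`, the admissible `t` for fixed `r` form an interval of
        -- length `(T - |r|)₊`.
        have hset : Set.Ioc (-r) (T - r) ∩ Set.Ioc 0 T =
            Set.Ioc (max (-r) 0) (min (T - r) T) := Set.Ioc_inter_Ioc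
        have hlen : max (min (T - r) T - max (-r) 0) 0 = max (T - |r|) 0 := by
          congr 1
          rcases le_total 0 r with h | h
          · rw [min_eq_left (by linarith), max_eq_right (by linarith), abs_of_nonneg h, sub_zero]
          · rw [min_eq_right (by linarith), max_eq_left (by linarith), abs_of_nonpos h]
        have hfun : (fun t => {p : ℝ × ℝ | p.2 + p.1 ∈ Set.Ioc 0 T}.indicator
            (fun p => g p.2) (t, r)) = (Set.Ioc (-r) (T - r)).indicator fun _ => g r := by
          funext t
          simp only [Set.indicator, Set.mem_ofPred_eq, Set.mem_Ioc]
          refine if_congr ?_ rfl rfl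
          constructor <;> rintro ⟨h1, h2⟩ <;> constructor <;> linarith
        rw [hfun, integral_indicator measurableSet_Ioc, Measure.restrict_restrict measurableSet_Ioc,
          hset, setIntegral_const, Real.volume_real_Ioc, hlen, smul_eq_mul, mul_comm]

end MeasureTheory

/-! ### Joint measurability and covariance of the squared process -/

namespace SecondMoment

variable {Ω : Type*} [MeasurableSpace Ω] {P : Measure Ω} {Z : ℝ≥0 → Ω → ℝ}

/-- A process with almost surely continuous paths is jointly measurable up to null sets. -/
theorem aestronglyMeasurable_eval_comp {α : Type*} [MeasurableSpace α] {μ : Measure α} [SFinite μ]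
    (hm : ∀ t, AEMeasurable (Z t) P) (hcont : ∀ᵐ ω ∂P, Continuous fun t => Z t ω)
    {τ : α → ℝ≥0} (hτ : Measurable τ) :
    AEStronglyMeasurable (fun p : Ω × α => Z (τ p.2) p.1) (P.prod μ) := by
  -- Rounding `τ` down to multiples of `1/n` leaves countably many times, hence countably many null
  -- sets; path continuity gives the limit.
  refine aestronglyMeasurable_of_tendsto_ae atTop
    (f := fun (n : ℕ) p => Z (⌊(τ p.2 : ℝ) * n⌋₊ / n) p.1) (fun n => ?_) ?_
  · have hmk : Measurable fun q : Ω × ℕ => (hm (q.2 / n)).mk _ q.1 :=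
      measurable_from_prod_countable_left fun k => (hm (k / n)).measurable_mk
    have hfl : Measurable fun p : Ω × α => (p.1, ⌊(τ p.2 : ℝ) * n⌋₊) :=
      measurable_fst.prodMk
        (Nat.measurable_floor.comp ((hτ.comp measurable_snd).coe_nnreal_real.mul_const _))
    refine (hmk.comp hfl).aestronglyMeasurable.congr ?_
    have hae : ∀ᵐ ω ∂P, ∀ k : ℕ, Z (k / n) ω = (hm (k / n)).mk _ ω :=
      ae_all_iff.2 fun k => (hm (k / n)).ae_eq_mk
    filter_upwards [Measure.quasiMeasurePreserving_fst.ae hae] with p hp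
    exact (hp _).symm
  · filter_upwards [Measure.quasiMeasurePreserving_fst.ae hcont] with p hp
    refine (hp.tendsto (τ p.2)).comp ?_
    rw [← NNReal.tendsto_coe]
    have := (tendsto_nat_floor_mul_div_atTop (NNReal.coe_nonneg (τ p.2))).comp
      (tendsto_natCast_atTop_atTop (R := ℝ))
    simpa [Function.comp_def] using this

theorem rho_abs (r : ℝ) : rho Z P |r| = rho Z P r := by
  have : Real.nnabs |r| = Real.nnabs r := by ext; simp
  rw [rho, rho, this]

theorem IsStationary.integral_mul (hstat : IsStationary Z P) (s t : ℝ≥0) :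
    ∫ ω, Z s ω * Z t ω ∂P = rho Z P (s - t) := by
  have key : ∀ s t : ℝ≥0, t ≤ s → ∫ ω, Z s ω * Z t ω ∂P = rho Z P (s - t) := by
    intro s t hts
    -- Shifting the times `s - t` and `0` by `t` gives `s` and `t`.
    have h := hstat t {s - t, 0}
    have hu : Measurable fun x : ({s - t, 0} : Finset ℝ≥0) → ℝ =>
        x ⟨s - t, by simp⟩ * x ⟨0, by simp⟩ := by fun_prop
    have h' := (h.comp hu).integral_eq
    simp only [Function.comp, zero_add, tsub_add_cancel_of_le hts] at h'
    rw [h', rho]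
    congr! 4
    ext
    rw [NNReal.coe_sub hts, Real.coe_nnabs, abs_of_nonneg (sub_nonneg.2 (NNReal.coe_le_coe.2 hts))]
  rcases le_total t s with h | h
  · exact key s t h
  · rw [← rho_abs, abs_sub_comm, rho_abs, ← key t s h]
    simp_rw [mul_comm]

theorem rho_zero : rho Z P 0 = secondMoment Z P := by
  simp [rho, secondMoment, sq]

theorem IsStationary.integral_sq (hstat : IsStationary Z P) (t : ℝ≥0) :
    ∫ ω, Z t ω ^ 2 ∂P = secondMoment Z P := by
  rw [← rho_zero, ← sub_self (t : ℝ), ← hstat.integral_mul]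
  simp_rw [sq]

theorem integrable_sub_mul_sub (hGauss : IsGaussianProcess Z P) (c : ℝ) (s t : ℝ≥0) :
    Integrable (fun ω => (Z s ω ^ 2 - c) * (Z t ω ^ 2 - c)) P := by
  have := hGauss.isProbabilityMeasure
  have hs := hGauss.hasGaussianLaw_eval s
  have ht := hGauss.hasGaussianLaw_eval t
  have h := ((hs.integrable_sq_mul_sq ht).sub
    (((hs.integrable_pow 2).add (ht.integrable_pow 2)).const_mul c)).add (integrable_const (c ^ 2))
  refine h.congr (.of_forall fun ω => ?_)
  simp only [Pi.add_apply, Pi.sub_apply]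
  ring

/-- The autocovariance of the squared process. -/
theorem integral_sub_mul_sub (hGauss : IsGaussianProcess Z P)
    (hcentered : ∀ t, ∫ ω, Z t ω ∂P = 0) (hstat : IsStationary Z P) (s t : ℝ≥0) :
    ∫ ω, (Z s ω ^ 2 - secondMoment Z P) * (Z t ω ^ 2 - secondMoment Z P) ∂P =
      2 * rho Z P (s - t) ^ 2 := by
  have := hGauss.isProbabilityMeasure
  have hs := hGauss.hasGaussianLaw_eval s
  have ht := hGauss.hasGaussianLaw_eval t
  set c := secondMoment Z P with hc
  have hM := hs.integrable_sq_mul_sq ht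
  have hS : Integrable (fun ω => c * (Z s ω ^ 2 + Z t ω ^ 2)) P :=
    ((hs.integrable_pow 2).add (ht.integrable_pow 2)).const_mul c
  have hD : Integrable (fun ω => Z s ω ^ 2 * Z t ω ^ 2 - c * (Z s ω ^ 2 + Z t ω ^ 2)) P := hM.sub hS
  calc ∫ ω, (Z s ω ^ 2 - c) * (Z t ω ^ 2 - c) ∂P
      = ∫ ω, (Z s ω ^ 2 * Z t ω ^ 2 - c * (Z s ω ^ 2 + Z t ω ^ 2)) + c ^ 2 ∂P := by
        congr 1 with ω
        ring
    _ = 2 * rho Z P (s - t) ^ 2 := by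
        rw [integral_add hD (integrable_const _), integral_sub hM hS, integral_const_mul,
          integral_add (hs.integrable_pow 2) (ht.integrable_pow 2), hstat.integral_sq,
          hstat.integral_sq, hGauss.hasGaussianLaw_prodMk.integral_sq_mul_sq (hcentered s)
          (hcentered t), hstat.integral_sq, hstat.integral_sq, hstat.integral_mul]
        simp
        ring

end SecondMoment

theorem MeasureTheory.MemLp.toReal_eLpNorm_two {Ω : Type*} [MeasurableSpace Ω] {P : Measure Ω}
    {f : Ω → ℝ} (hf : MemLp f 2 P) : (eLpNorm f 2 P).toReal = √(∫ ω, f ω ^ 2 ∂P) := by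
  rw [hf.eLpNorm_eq_integral_rpow_norm (by simp) (by simp), ENNReal.toReal_ofReal (by positivity),
    Real.sqrt_eq_rpow]
  simp

/-! ### Mean and variance of the estimator -/

namespace SecondMoment

variable {Ω : Type*} [MeasurableSpace Ω] {P : Measure Ω} {Z : ℝ≥0 → Ω → ℝ}

theorem integrable_sq_prod (hGauss : IsGaussianProcess Z P) (hstat : IsStationary Z P)
    (hcont : ∀ᵐ ω ∂P, Continuous fun t => Z t ω) (T : ℝ) :
    Integrable (fun p : Ω × ℝ => Z p.2.toNNReal p.1 ^ 2)
      (P.prod (volume.restrict (Set.Ioc 0 T))) := by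
  have := hGauss.isProbabilityMeasure
  have hm : AEStronglyMeasurable (fun p : Ω × ℝ => Z p.2.toNNReal p.1 ^ 2)
      (P.prod (volume.restrict (Set.Ioc 0 T))) :=
    (aestronglyMeasurable_eval_comp hGauss.aemeasurable hcont measurable_real_toNNReal).pow 2
  refine (integrable_prod_iff' hm).2
    ⟨.of_forall fun t => (hGauss.hasGaussianLaw_eval t.toNNReal).integrable_pow 2, ?_⟩
  simp only [norm_pow, Real.norm_eq_abs, sq_abs, hstat.integral_sq]
  exact integrable_const _

theorem integrable_estimator (hGauss : IsGaussianProcess Z P) (hstat : IsStationary Z P)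
    (hcont : ∀ᵐ ω ∂P, Continuous fun t => Z t ω) {T : ℝ} (hT : 0 < T) :
    Integrable (estimator Z T) P := by
  have := (integrable_sq_prod hGauss hstat hcont T).integral_prod_left.const_mul (1 / T)
  simp only [← intervalIntegral.integral_of_le hT.le] at this
  exact this

theorem integral_estimator (hGauss : IsGaussianProcess Z P) (hstat : IsStationary Z P)
    (hcont : ∀ᵐ ω ∂P, Continuous fun t => Z t ω) {T : ℝ} (hT : 0 < T) :
    ∫ ω, estimator Z T ω ∂P = secondMoment Z P := by
  have := hGauss.isProbabilityMeasure
  simp only [estimator, intervalIntegral.integral_of_le hT.le]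
  rw [integral_const_mul, integral_integral_swap (integrable_sq_prod hGauss hstat hcont T)]
  simp only [hstat.integral_sq]
  simp [hT.le]
  field_simp

/-- Splitting the integral requires `Z²` to be integrable along the path, which Fubini provides for
almost every path. -/
theorem estimator_sub_ae_eq (hGauss : IsGaussianProcess Z P) (hstat : IsStationary Z P)
    (hcont : ∀ᵐ ω ∂P, Continuous fun t => Z t ω) {T : ℝ} (hT : 0 < T) :
    ∀ᵐ ω ∂P, estimator Z T ω - secondMoment Z P =
      (1 / T) * ∫ t in Set.Ioc 0 T, (Z t.toNNReal ω ^ 2 - secondMoment Z P) := by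
  have := hGauss.isProbabilityMeasure
  filter_upwards [(integrable_sq_prod hGauss hstat hcont T).prod_right_ae] with ω hω
  rw [integral_sub hω (integrable_const _), estimator, intervalIntegral.integral_of_le hT.le]
  simp [hT.le]
  field_simp

/-- This licenses Fubini for the squared error: `|ab| ≤ (a² + b²)/2` and stationarity bound the
inner expectation by `2ρ(0)²`, uniformly on a square of finite measure. -/
theorem integrable_sub_mul_sub_prod (hGauss : IsGaussianProcess Z P)
    (hcentered : ∀ t, ∫ ω, Z t ω ∂P = 0) (hstat : IsStationary Z P)
    (hcont : ∀ᵐ ω ∂P, Continuous fun t => Z t ω) (T : ℝ) :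
    Integrable (fun p : Ω × ℝ × ℝ => (Z p.2.1.toNNReal p.1 ^ 2 - secondMoment Z P) *
        (Z p.2.2.toNNReal p.1 ^ 2 - secondMoment Z P))
      (P.prod ((volume.restrict (Set.Ioc 0 T)).prod (volume.restrict (Set.Ioc 0 T)))) := by
  have := hGauss.isProbabilityMeasure
  set μ : Measure ℝ := volume.restrict (Set.Ioc 0 T)
  set c := secondMoment Z P
  have hm1 : AEStronglyMeasurable (fun p : Ω × ℝ × ℝ => Z p.2.1.toNNReal p.1)
      (P.prod (μ.prod μ)) :=
    aestronglyMeasurable_eval_comp hGauss.aemeasurable hcont (measurable_fst.real_toNNReal)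
  have hm2 : AEStronglyMeasurable (fun p : Ω × ℝ × ℝ => Z p.2.2.toNNReal p.1)
      (P.prod (μ.prod μ)) :=
    aestronglyMeasurable_eval_comp hGauss.aemeasurable hcont (measurable_snd.real_toNNReal)
  have hm : AEStronglyMeasurable (fun p : Ω × ℝ × ℝ => (Z p.2.1.toNNReal p.1 ^ 2 - c) *
      (Z p.2.2.toNNReal p.1 ^ 2 - c)) (P.prod (μ.prod μ)) :=
    ((hm1.pow 2).sub aestronglyMeasurable_const).mul ((hm2.pow 2).sub aestronglyMeasurable_const)
  refine (integrable_prod_iff' hm).2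
    ⟨.of_forall fun q => integrable_sub_mul_sub hGauss c q.1.toNNReal q.2.toNNReal, ?_⟩
  refine Integrable.of_bound hm.norm.prod_swap.integral_prod_right' (2 * rho Z P 0 ^ 2)
    (.of_forall fun q => ?_)
  have hv : ∀ t : ℝ≥0, ∫ ω, (Z t ω ^ 2 - c) * (Z t ω ^ 2 - c) ∂P = 2 * rho Z P 0 ^ 2 := fun t => by
    rw [integral_sub_mul_sub hGauss hcentered hstat, sub_self]
  rw [Real.norm_of_nonneg (integral_nonneg fun _ => norm_nonneg _)]
  have hi := fun t : ℝ≥0 => integrable_sub_mul_sub hGauss c t t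
  calc ∫ ω, ‖(Z q.1.toNNReal ω ^ 2 - c) * (Z q.2.toNNReal ω ^ 2 - c)‖ ∂P
      ≤ ∫ ω, ((Z q.1.toNNReal ω ^ 2 - c) * (Z q.1.toNNReal ω ^ 2 - c) +
          (Z q.2.toNNReal ω ^ 2 - c) * (Z q.2.toNNReal ω ^ 2 - c)) / 2 ∂P := by
        refine integral_mono (integrable_sub_mul_sub hGauss c q.1.toNNReal q.2.toNNReal).norm
          (((hi q.1.toNNReal).add (hi q.2.toNNReal)).div_const 2) fun ω => ?_
        simp only [Real.norm_eq_abs]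
        rw [abs_le]
        constructor <;>
        nlinarith [sq_nonneg ((Z q.1.toNNReal ω ^ 2 - c) - (Z q.2.toNNReal ω ^ 2 - c)),
          sq_nonneg ((Z q.1.toNNReal ω ^ 2 - c) + (Z q.2.toNNReal ω ^ 2 - c))]
    _ = 2 * rho Z P 0 ^ 2 := by
        rw [integral_div, integral_add (hi q.1.toNNReal) (hi q.2.toNNReal), hv, hv]
        ring

theorem integrable_sq_integral (hGauss : IsGaussianProcess Z P)
    (hcentered : ∀ t, ∫ ω, Z t ω ∂P = 0) (hstat : IsStationary Z P)
    (hcont : ∀ᵐ ω ∂P, Continuous fun t => Z t ω) (T : ℝ) :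
    Integrable (fun ω => (∫ t in Set.Ioc 0 T, (Z t.toNNReal ω ^ 2 - secondMoment Z P)) ^ 2) P := by
  refine (integrable_sub_mul_sub_prod hGauss hcentered hstat hcont T).integral_prod_left.congr
    (.of_forall fun ω => ?_)
  dsimp only
  rw [integral_prod_mul (fun s : ℝ => Z s.toNNReal ω ^ 2 - secondMoment Z P)
    (fun t : ℝ => Z t.toNNReal ω ^ 2 - secondMoment Z P), sq]

theorem integral_sq_integral (hGauss : IsGaussianProcess Z P)
    (hcentered : ∀ t, ∫ ω, Z t ω ∂P = 0) (hstat : IsStationary Z P)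
    (hcont : ∀ᵐ ω ∂P, Continuous fun t => Z t ω)
    (hrho : Integrable (fun r : ℝ => rho Z P r ^ 2)) (T : ℝ) :
    ∫ ω, (∫ t in Set.Ioc 0 T, (Z t.toNNReal ω ^ 2 - secondMoment Z P)) ^ 2 ∂P =
      2 * ∫ r, rho Z P r ^ 2 * max (T - |r|) 0 := by
  have := hGauss.isProbabilityMeasure
  have hint := integrable_sub_mul_sub_prod hGauss hcentered hstat hcont T
  have hint2 := hint.integral_prod_right
  simp_rw [sq (∫ t in Set.Ioc 0 T, _), ← integral_prod_mul]
  -- The symmetric form puts the first time variable innermost, matching the kernel `s - t`.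
  rw [integral_integral_swap hint, integral_prod_symm _ hint2, ← integral_integral_sub_Ioc hrho,
    ← integral_const_mul]
  refine setIntegral_congr_fun measurableSet_Ioc fun t ht => ?_
  rw [← integral_const_mul]
  refine setIntegral_congr_fun measurableSet_Ioc fun s hs => ?_
  dsimp only
  rw [integral_sub_mul_sub hGauss hcentered hstat, Real.coe_toNNReal _ hs.1.le,
    Real.coe_toNNReal _ ht.1.le]

theorem memLp_estimator_sub (hGauss : IsGaussianProcess Z P)
    (hcentered : ∀ t, ∫ ω, Z t ω ∂P = 0) (hstat : IsStationary Z P)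
    (hcont : ∀ᵐ ω ∂P, Continuous fun t => Z t ω) {T : ℝ} (hT : 0 < T) :
    MemLp (fun ω => estimator Z T ω - secondMoment Z P) 2 P := by
  have := hGauss.isProbabilityMeasure
  refine (memLp_two_iff_integrable_sq ((integrable_estimator hGauss hstat hcont
    hT).aestronglyMeasurable.sub aestronglyMeasurable_const)).2 ?_
  refine ((integrable_sq_integral hGauss hcentered hstat hcont T).const_mul ((1 / T) ^ 2)).congr ?_
  filter_upwards [estimator_sub_ae_eq hGauss hstat hcont hT] with ω hω
  rw [Pi.sub_apply, hω]
  ring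

/-- The variance of the estimator. -/
theorem integral_estimator_sub_sq (hGauss : IsGaussianProcess Z P)
    (hcentered : ∀ t, ∫ ω, Z t ω ∂P = 0) (hstat : IsStationary Z P)
    (hcont : ∀ᵐ ω ∂P, Continuous fun t => Z t ω)
    (hrho : Integrable (fun r : ℝ => rho Z P r ^ 2)) {T : ℝ} (hT : 0 < T) :
    ∫ ω, (estimator Z T ω - secondMoment Z P) ^ 2 ∂P =
      2 / T * ∫ r, rho Z P r ^ 2 * max (1 - |r| / T) 0 := by
  calc ∫ ω, (estimator Z T ω - secondMoment Z P) ^ 2 ∂P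
      = ∫ ω, (1 / T) ^ 2 *
          (∫ t in Set.Ioc 0 T, (Z t.toNNReal ω ^ 2 - secondMoment Z P)) ^ 2 ∂P := by
        refine integral_congr_ae ?_
        filter_upwards [estimator_sub_ae_eq hGauss hstat hcont hT] with ω hω
        rw [hω]
        ring
    _ = 2 / T * (1 / T * ∫ r, rho Z P r ^ 2 * max (T - |r|) 0) := by
        rw [integral_const_mul, integral_sq_integral hGauss hcentered hstat hcont hrho]
        ring
    _ = 2 / T * ∫ r, rho Z P r ^ 2 * max (1 - |r| / T) 0 := by
        rw [← integral_const_mul]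
        congr 2 with r
        have : max (T - |r|) 0 = T * max (1 - |r| / T) 0 := by
          rw [mul_max_of_nonneg _ _ hT.le, mul_zero]
          congr 1
          field_simp
        rw [this]
        field_simp

theorem scaledError_eq (hGauss : IsGaussianProcess Z P)
    (hcentered : ∀ t, ∫ ω, Z t ω ∂P = 0) (hstat : IsStationary Z P)
    (hcont : ∀ᵐ ω ∂P, Continuous fun t => Z t ω)
    (hrho : Integrable (fun r : ℝ => rho Z P r ^ 2)) {T : ℝ} (hT : 0 < T) :
    scaledError Z P T = √(2 * ∫ r, rho Z P r ^ 2 * max (1 - |r| / T) 0) := by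
  rw [scaledError, (memLp_estimator_sub hGauss hcentered hstat hcont hT).toReal_eLpNorm_two,
    ← Real.sqrt_mul hT.le, integral_estimator_sub_sq hGauss hcentered hstat hcont hrho hT]
  congr 1
  field_simp

/-! ### The triangular weight and the limiting variance -/

theorem max_one_sub_abs_div_mem_Icc {T : ℝ} (hT : 0 < T) (r : ℝ) :
    max (1 - |r| / T) 0 ∈ Set.Icc (0 : ℝ) 1 :=
  ⟨le_max_right _ _, max_le (by have : 0 ≤ |r| / T := by positivity
                                linarith) zero_le_one⟩

theorem integrable_rho_sq_mul (hrho : Integrable (fun r : ℝ => rho Z P r ^ 2)) {T : ℝ}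
    (hT : 0 < T) : Integrable fun r => rho Z P r ^ 2 * max (1 - |r| / T) 0 := by
  refine hrho.mul_bdd (c := 1) (by fun_prop) (.of_forall fun r => ?_)
  have h := max_one_sub_abs_div_mem_Icc hT r
  rw [Real.norm_of_nonneg h.1]
  exact h.2

theorem integral_rho_sq_mul_mono (hrho : Integrable (fun r : ℝ => rho Z P r ^ 2)) :
    MonotoneOn (fun T : ℝ => ∫ r, rho Z P r ^ 2 * max (1 - |r| / T) 0) (Set.Ioi 0) := by
  intro S hS T hT hST
  rw [Set.mem_Ioi] at hS hT
  refine integral_mono (integrable_rho_sq_mul hrho hS) (integrable_rho_sq_mul hrho hT) fun r => ?_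
  dsimp only
  gcongr

theorem tendsto_integral_rho_sq_mul (hrho : Integrable (fun r : ℝ => rho Z P r ^ 2)) :
    Tendsto (fun T : ℝ => ∫ r, rho Z P r ^ 2 * max (1 - |r| / T) 0) atTop
      (𝓝 (∫ r, rho Z P r ^ 2)) := by
  refine tendsto_integral_filter_of_dominated_convergence (fun r => rho Z P r ^ 2) ?_ ?_ hrho ?_
  · filter_upwards [eventually_gt_atTop 0] with T hT
    exact (integrable_rho_sq_mul hrho hT).aestronglyMeasurable
  · filter_upwards [eventually_gt_atTop 0] with T hT
    refine .of_forall fun r => ?_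
    have h := max_one_sub_abs_div_mem_Icc hT r
    rw [Real.norm_of_nonneg (mul_nonneg (sq_nonneg _) h.1)]
    exact mul_le_of_le_one_right (sq_nonneg _) h.2
  · refine .of_forall fun r => ?_
    have h : Tendsto (fun T : ℝ => |r| / T) atTop (𝓝 0) := tendsto_const_nhds.div_atTop tendsto_id
    simpa using ((h.const_sub 1).max (tendsto_const_nhds (x := (0 : ℝ)))).const_mul (rho Z P r ^ 2)

/-- Evenness of `ρ` doubles the half-line integral. -/
theorem sigma_eq : sigma Z P = √(2 * ∫ r, rho Z P r ^ 2) := by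
  have h := integral_comp_abs (f := fun r => rho Z P r ^ 2)
  simp only [rho_abs] at h
  rw [sigma, h]
  ring_nf

/-! ### Strong consistency -/

theorem tendsto_estimator (hGauss : IsGaussianProcess Z P)
    (hcentered : ∀ t, ∫ ω, Z t ω ∂P = 0) (hstat : IsStationary Z P)
    (hcont : ∀ᵐ ω ∂P, Continuous fun t => Z t ω)
    (hrho : Integrable (fun r : ℝ => rho Z P r ^ 2)) :
    ∀ᵐ ω ∂P, Tendsto (fun T : ℝ => estimator Z T ω) atTop (𝓝 (secondMoment Z P)) := by
  have hpos : ∀ n : ℕ, (0 : ℝ) < ((n : ℝ) + 1) ^ 2 := fun n => by positivity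
  -- Dropping the weight, which is at most `1`, bounds the variance at time `(n + 1)²` by a constant
  -- over `(n + 1)²`; the shift avoids time `0`.
  have hsum : Summable fun n : ℕ =>
      ∫ ω, (estimator Z (((n : ℝ) + 1) ^ 2) ω - secondMoment Z P) ^ 2 ∂P := by
    have hs : Summable fun n : ℕ => (2 * ∫ r, rho Z P r ^ 2) * (1 / ((n : ℝ) + 1) ^ 2) := by
      refine Summable.mul_left _ ?_
      have := (summable_nat_add_iff 1).2 (Real.summable_one_div_nat_pow.2 one_lt_two)
      simpa using this
    refine hs.of_nonneg_of_le (fun n => integral_nonneg fun _ => sq_nonneg _) fun n => ?_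
    rw [integral_estimator_sub_sq hGauss hcentered hstat hcont hrho (hpos n)]
    have hle : ∫ r, rho Z P r ^ 2 * max (1 - |r| / ((n : ℝ) + 1) ^ 2) 0 ≤ ∫ r, rho Z P r ^ 2 :=
      integral_mono (integrable_rho_sq_mul hrho (hpos n)) hrho fun r =>
        mul_le_of_le_one_right (sq_nonneg _) (max_one_sub_abs_div_mem_Icc (hpos n) r).2
    calc _ ≤ 2 / ((n : ℝ) + 1) ^ 2 * ∫ r, rho Z P r ^ 2 := by gcongr
      _ = _ := by ring
  filter_upwards [hcont, ae_tendsto_zero_of_summable_integral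
    (fun n => (memLp_estimator_sub hGauss hcentered hstat hcont (hpos n)).integrable_sq)
    (fun _ _ => sq_nonneg _) hsum] with ω hω hlim
  have hc : Continuous fun t : ℝ => Z t.toNNReal ω ^ 2 :=
    (hω.comp continuous_real_toNNReal).pow 2
  have hmono : MonotoneOn (fun T : ℝ => ∫ t in (0 : ℝ)..T, Z t.toNNReal ω ^ 2) (Set.Ici 0) :=
    fun S hS T _ hST => intervalIntegral.integral_mono_interval le_rfl hS hST
      (.of_forall fun t => sq_nonneg _) (hc.intervalIntegrable _ _)
  have hdiv : ∀ T : ℝ, estimator Z T ω = (∫ t in (0 : ℝ)..T, Z t.toNNReal ω ^ 2) / T :=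
    fun T => by rw [estimator, one_div, inv_mul_eq_div]
  simp only [hdiv] at hlim ⊢
  refine hmono.tendsto_div_of_tendsto_sq (by simp) ?_
  have h := hlim.sqrt
  simp only [Real.sqrt_sq_eq_abs, Real.sqrt_zero] at h
  exact tendsto_sub_nhds_zero_iff.1 ((tendsto_zero_iff_abs_tendsto_zero _).2 h)

end SecondMoment

theorem mainTheorem12 {Ω : Type*} [MeasurableSpace Ω] (P : Measure Ω) [IsProbabilityMeasure P]
    (Z : ℝ≥0 → Ω → ℝ)
    (hGauss : IsGaussianProcess Z P)
    (hcentered : ∀ t, ∫ ω, Z t ω ∂P = 0)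
    (hstat : SecondMoment.IsStationary Z P)
    (hcont : ∀ᵐ ω ∂P, Continuous fun t => Z t ω)
    (hrho : Integrable (fun r : ℝ => SecondMoment.rho Z P r ^ 2)) :
    -- unbiasedness
    (∀ T : ℝ, 0 < T →
      Integrable (SecondMoment.estimator Z T) P ∧
        ∫ ω, SecondMoment.estimator Z T ω ∂P = SecondMoment.secondMoment Z P) ∧
    -- strong consistency
    (∀ᵐ ω ∂P, Tendsto (fun T : ℝ => SecondMoment.estimator Z T ω) atTop
      (𝓝 (SecondMoment.secondMoment Z P))) ∧
    -- monotone convergence of the normalized error, which is finite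
    (∀ T : ℝ, 0 < T →
      MemLp (fun ω => SecondMoment.estimator Z T ω - SecondMoment.secondMoment Z P) 2 P) ∧
    MonotoneOn (SecondMoment.scaledError Z P) (Set.Ioi 0) ∧
    Tendsto (SecondMoment.scaledError Z P) atTop (𝓝 (SecondMoment.sigma Z P)) := by
  have heq := fun T (hT : 0 < T) =>
    SecondMoment.scaledError_eq hGauss hcentered hstat hcont hrho hT
  refine ⟨fun T hT => ⟨SecondMoment.integrable_estimator hGauss hstat hcont hT,
      SecondMoment.integral_estimator hGauss hstat hcont hT⟩,
    SecondMoment.tendsto_estimator hGauss hcentered hstat hcont hrho,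
    fun T hT => SecondMoment.memLp_estimator_sub hGauss hcentered hstat hcont hT, ?_, ?_⟩
  · intro S hS T hT hST
    rw [heq S hS, heq T hT]
    exact Real.sqrt_le_sqrt (mul_le_mul_of_nonneg_left
      (SecondMoment.integral_rho_sq_mul_mono hrho hS hT hST) zero_le_two)
  · rw [SecondMoment.sigma_eq]
    refine (((SecondMoment.tendsto_integral_rho_sq_mul hrho).const_mul 2).sqrt).congr' ?_
    filter_upwards [eventually_gt_atTop 0] with T hT
    exact (heq T hT).symm
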